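/- \textbf{Theorem (Completeness for multiple definitions in the antecedent).} Let $\tau$ be any set of propositional atoms, $D_1,\dots,D_n$ ($n\ge 0$) definitions over $\tau$, and $\Gamma,\Delta$ finite sets of PC-formulas over $\tau$. If the sequent $D_1,\dots,D_n,\Gamma\to\Delta$ is valid, then it is provable in the sequent calculus for PC(ID) described below. \textbf{Syntax.} PC-formulas over $\tau$ are built from the atoms of $\tau$ and the constants $\top,\bot$ by $\neg,\wedge,\vee$. A \emph{definition} $D$ over $\tau$ is a finite set of rules $P\leftarrow\varphi$ with head $P\in\tau$ and body $\varphi$ a PC-formula over $\tau$, in which each atom is the head of at most one rule. The heads form the set $\mathrm{Def}(D)$ of \emph{defined} atoms, and the body of the rule for $P$ is denoted $\varphi_P$; all other atoms are \emph{open}. PC(ID)-formulas are built from atoms, $\top$, $\bot$ and definitions by $\neg,\wedge,\vee$; $F\equiv G$ abbreviates $(F\wedge G)\vee(\neg F\wedge\neg G)$. A \emph{sequent} is an expression $\Gamma\to\Delta$ with $\Gamma,\Delta$ finite sets of PC(ID)-formulas; a comma denotes union, and a formula denotes its singleton. An occurrence of an atom is positive (negative) if it is in the scope of an even (odd) number of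 negations. \textbf{Semantics.} Interpretations map atoms to $\mathbf f<\mathbf u<\mathbf t$; on formulas $\wedge,\vee$ are $\min,\max$, and $\neg$ exchanges $\mathbf f,\mathbf t$ and fixes $\mathbf u$. $I[U/v]$ is $I$ with all atoms of $U$ given the value $v$. Given a two-valued interpretation $I_O$ of the open atoms of $D$, a \emph{well-founded induction} of $D$ is a sequence of interpretations that extend $I_O$, starting with all defined atoms $\mathbf u$, in which each $I^{k+1}$ is either $I^k[\{P\}/\mathbf t]$ for some $P\in\mathrm{Def}(D)$ with $I^k(P)=\mathbf u$ and $\varphi_P^{I^k}=\mathbf t$, or $I^k[U/\mathbf f]$ for some nonempty $U\subseteq\mathrm{Def}(D)$ such that $I^k(P)=\mathbf u$ and $\varphi_P^{I^{k+1}}=\mathbf f$ for all $P\in U$. It is \emph{terminal} if it cannot be extended. The limit $I_O^D$ of a terminal well-founded induction is the \emph{well-founded partial interpretation} of $D$ extending $I_O$. $D$ is true in $I$ if $I$ is two-valued and $I$ is the well-founded partial interpretation of $D$ extending the restriction of $I$ to the open atoms; otherwise $D$ is false in $I$. $D$ is \emph{total} if $I_O^D$ is two-valued for every two-valued $I_O$.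 A \emph{model} of a formula is a two-valued interpretation in which the formula is true. $\Gamma\to\Delta$ is \emph{valid} if every two-valued interpretation that is a model of all formulas in $\Gamma$ is a model of some formula in $\Delta$. \textbf{Calculus.} A sequent is \emph{provable} if it is the root of a finite tree of sequents whose leaves are axioms (or conclusions of rule instances without premises) and in which every other node follows from its children by a rule. \begin{itemize} \item Axioms: $\Gamma,A\to A,\Delta$; $\ \bot\to\Delta$; $\ \Gamma\to\top$. \item Structural rules: left and right weakening, left and right contraction, and cut (from $\Gamma\to\Delta,A$ and $A,\Gamma\to\Delta$ infer $\Gamma\to\Delta$). \item Logical rules: from $\Gamma\to\Delta,A$ infer $\neg A,\Gamma\to\Delta$; from $A,\Gamma\to\Delta$ infer $\Gamma\to\Delta,\neg A$; from $A,B,\Gamma\to\Delta$ infer $A\wedge B,\Gamma\to\Delta$; from $\Gamma\to\Delta,A$ and $\Gamma\to\Delta,B$ infer $\Gamma\to\Delta,A\wedge B$; from $A,\Gamma\to\Delta$ and $B,\Gamma\to\Delta$ infer $A\vee B,\Gamma\to\Delta$; from $\Gamma\to\Delta,A,B$ infer $\Gamma\to\Delta,A\vee B$. \item Right definition rule, for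 $P\in\mathrm{Def}(D)$: from $\Gamma\to\Delta,\varphi_P$ infer $D,\Gamma\to\Delta,P$. \item Left definition rule, for $\emptyset\ne U\subseteq\mathrm{Def}(D)$ and $P\in U$: from the sequents $\{\neg Q^{\triangleright}: Q\in U\},\Gamma\to\Delta,\neg\varphi_R^{\triangleright}$, one for every $R\in U$, infer $P,D,\Gamma\to\Delta$. Here the $Q^{\triangleright}$ ($Q\in U$) are distinct new atoms, and $\varphi^{\triangleright}$ is $\varphi$ with each positive occurrence of each $Q\in U$ replaced by $Q^{\triangleright}$. \item Non-total definition rule, for $\emptyset\ne V\subseteq\mathrm{Def}(D)$: from $V^{\diamond},D^{\diamond},\Gamma\to\Delta,\bigwedge_{P\in V}\neg P^{\triangleright}$ and $\{\neg P^{\diamond}:P\in V\},D^{\diamond},\Gamma\to\Delta,\bigwedge_{P\in V}P^{\triangleright}$ infer $D,\Gamma\to\Delta$. Here $P^{\triangleright},P^{\diamond}$ ($P\in V$) are distinct new atoms, $V^{\diamond}=\{P^{\diamond}:P\in V\}$ and $D^{\diamond}=\{P^{\triangleright}\leftarrow\varphi_P^{\diamond}: P\in V\}$, where $\varphi^{\diamond}$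 is $\varphi$ with each positive (negative) occurrence of each $P\in V$ replaced by $P^{\triangleright}$ ($P^{\diamond}$). \item Definition introduction rule, for a total definition $D$: from the sequents $D',\Gamma\to\Delta,P'\equiv P$, one for every $P\in\mathrm{Def}(D)$, infer $\Gamma\to\Delta,D$. Here the $P'$ are distinct new atoms, and $D'$ is $D$ with all occurrences of each $P\in\mathrm{Def}(D)$ replaced by $P'$. \end{itemize} In the last three rules $D,\Gamma,\Delta$ are over the vocabulary $\tau$ of the conclusion, and the premises are over $\tau$ enlarged by the new atoms; in all other rules premises and conclusion have the same vocabulary. -/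

import Mathlib

universe u v

namespace PCID

/-! ### Syntax -/

/-- PC-formulas over the vocabulary `τ` (with the logical constants `⊤` and `⊥`). -/
inductive PCFormula (τ : Type u) : Type u
  | atom : τ → PCFormula τ
  | top : PCFormula τ
  | bot : PCFormula τ
  | neg : PCFormula τ → PCFormula τ
  | and : PCFormula τ → PCFormula τ → PCFormula τ
  | or : PCFormula τ → PCFormula τ → PCFormula τ

/-- Replace every positive occurrence of an atom `P` by `p P` and every negative occurrence
of `P` by `n P`. -/
def PCFormula.rename {τ : Type u} {σ : Type v} :
    (p n : τ → σ) → PCFormula τ → PCFormula σ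
  | p, _, .atom P => .atom (p P)
  | _, _, .top => .top
  | _, _, .bot => .bot
  | p, n, .neg φ => .neg (φ.rename n p)
  | p, n, .and φ ψ => .and (φ.rename p n) (ψ.rename p n)
  | p, n, .or φ ψ => .or (φ.rename p n) (ψ.rename p n)

/-- A definition over `τ`: a finite set of rules `P ← φ`, where the pair `(P, φ)` stands for the
rule with head `P` and body `φ`; every atom is the head of at most one rule. -/
structure Definition (τ : Type u) : Type u where
  rules : Finset (τ × PCFormula τ)
  unique_rule : ∀ P φ ψ, (P, φ) ∈ rules → (P, ψ) ∈ rules → φ = ψ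

/-- The set of defined atoms of `D`; all other atoms are open. -/
def Definition.defined {τ : Type u} (D : Definition τ) : Set τ :=
  {P | ∃ φ, (P, φ) ∈ D.rules}

open Classical in
/-- Rename the heads and the positive occurrences of atoms in the bodies by `pos`, and the negative
occurrences in the bodies by `neg`. -/
noncomputable def Definition.rename {τ : Type u} {σ : Type v} (pos : τ ↪ σ) (neg : τ → σ)
    (D : Definition τ) : Definition σ where
  rules := D.rules.image fun r => (pos r.1, r.2.rename pos neg)
  unique_rule := by
    intro P φ ψ h₁ h₂
    simp only [Finset.mem_image, Prod.mk.injEq, Prod.exists] at h₁ h₂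
    obtain ⟨A, α, hA, rfl, rfl⟩ := h₁
    obtain ⟨B, β, hB, hBA, rfl⟩ := h₂
    obtain rfl := pos.injective hBA
    rw [D.unique_rule B α β hA hB]

open Classical in
/-- The rules of `D` whose head is in `V`. -/
noncomputable def Definition.restrict {τ : Type u} (D : Definition τ) (V : Finset τ) :
    Definition τ where
  rules := D.rules.filter fun r => r.1 ∈ V
  unique_rule := by
    intro P φ ψ h₁ h₂
    exact D.unique_rule P φ ψ (Finset.mem_filter.1 h₁).1 (Finset.mem_filter.1 h₂).1

/-- PC(ID)-formulas over the vocabulary `τ` (with the logical constants `⊤` and `⊥`). -/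
inductive Formula (τ : Type u) : Type u
  | atom : τ → Formula τ
  | top : Formula τ
  | bot : Formula τ
  | defn : Definition τ → Formula τ
  | neg : Formula τ → Formula τ
  | and : Formula τ → Formula τ → Formula τ
  | or : Formula τ → Formula τ → Formula τ

noncomputable instance {τ : Type u} : DecidableEq (Formula τ) := Classical.decEq _

/-- Every PC-formula is a PC(ID)-formula. -/
def PCFormula.toFormula {τ : Type u} : PCFormula τ → Formula τ
  | .atom P => .atom P
  | .top => .top
  | .bot => .bot
  | .neg φ => .neg φ.toFormula
  | .and φ ψ => .and φ.toFormula ψ.toFormula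
  | .or φ ψ => .or φ.toFormula ψ.toFormula

/-- A formula over `τ`, regarded as a formula over a larger vocabulary `σ`. -/
noncomputable def Formula.lift {τ : Type u} {σ : Type v} (f : τ ↪ σ) : Formula τ → Formula σ
  | .atom P => .atom (f P)
  | .top => .top
  | .bot => .bot
  | .defn D => .defn (D.rename f f)
  | .neg φ => .neg (φ.lift f)
  | .and φ ψ => .and (φ.lift f) (ψ.lift f)
  | .or φ ψ => .or (φ.lift f) (ψ.lift f)

/-- The abbreviation `F ≡ G` for `(F ∧ G) ∨ (¬F ∧ ¬G)`. -/
def Formula.equiv {τ : Type u} (F G : Formula τ) : Formula τ :=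
  .or (.and F G) (.and (.neg F) (.neg G))

/-- The conjunction of a nonempty list of formulas (`⊤` for the empty list). -/
def Formula.conj {τ : Type u} : List (Formula τ) → Formula τ
  | [] => .top
  | [F] => F
  | F :: G :: l => .and F (Formula.conj (G :: l))

/-! ### Semantics -/

/-- The truth values: false is `-1`, unknown is `0`, true is `1`. The truth order is the order
`-1 < 0 < 1`, and the inverse of a truth value is its negation. -/
abbrev TruthValue := SignType

/-- Three-valued interpretations of the vocabulary `τ`. -/
abbrev Interpretation (τ : Type u) := τ → TruthValue

def Interpretation.TwoValued {τ : Type u} (I : Interpretation τ) : Prop := ∀ P, I P ≠ 0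

/-- The truth value of a PC-formula in a three-valued interpretation. -/
def PCFormula.eval {τ : Type u} (I : Interpretation τ) : PCFormula τ → TruthValue
  | .atom P => I P
  | .top => 1
  | .bot => -1
  | .neg φ => -(φ.eval I)
  | .and φ ψ => min (φ.eval I) (ψ.eval I)
  | .or φ ψ => max (φ.eval I) (ψ.eval I)

open Classical in
/-- The interpretation `I[U/v]`. -/
noncomputable def Interpretation.update {τ : Type u} (I : Interpretation τ) (U : Set τ)
    (v : TruthValue) : Interpretation τ :=
  fun P => if P ∈ U then v else I P

/-- One step of a well-founded induction for `D`: either an underived defined atom with a true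
body is made true, or a nonempty set of underived defined atoms, all of whose bodies are false
once these atoms are false, is made false. -/
inductive Definition.Step {τ : Type u} (D : Definition τ) :
    Interpretation τ → Interpretation τ → Prop
  | derive_true (I : Interpretation τ) (P : τ) (φ : PCFormula τ)
      (hP : I P = 0) (hr : (P, φ) ∈ D.rules) (hφ : φ.eval I = 1) :
      D.Step I (I.update {P} 1)
  | derive_false (I : Interpretation τ) (U : Set τ) (hne : U.Nonempty) (hU : U ⊆ D.defined)
      (hu : ∀ P ∈ U, I P = 0)
      (hφ : ∀ P ∈ U, ∀ φ, (P, φ) ∈ D.rules → φ.eval (I.update U (-1)) = -1) :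
      D.Step I (I.update U (-1))

/-- `J` is the limit of a terminal well-founded induction for `D` extending the restriction of `I`
to the open atoms of `D`, i.e. `J` is the well-founded partial interpretation of `D` extending
that restriction. As `D` has finitely many rules, and every step derives at least one more defined
atom, all well-founded inductions are finite. -/
def Definition.IsWellFoundedLimit {τ : Type u} (D : Definition τ) (I J : Interpretation τ) : Prop :=
  Relation.ReflTransGen D.Step (I.update D.defined 0) J ∧ ∀ J', ¬ D.Step J J'

/-- `D` is true in `I`: `I` is two-valued, and it is the well-founded partial interpretation of `D`
extending its own restriction to the open atoms of `D`. -/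
def Definition.HoldsIn {τ : Type u} (D : Definition τ) (I : Interpretation τ) : Prop :=
  I.TwoValued ∧ D.IsWellFoundedLimit I I

/-- `D` is total: for every two-valued interpretation of its open atoms, the well-founded partial
interpretation of `D` extending it is two-valued. -/
def Definition.Total {τ : Type u} (D : Definition τ) : Prop :=
  ∀ I : Interpretation τ, I.TwoValued →
    ∃ J : Interpretation τ, D.IsWellFoundedLimit I J ∧ J.TwoValued

open Classical in
/-- The truth value of a PC(ID)-formula. -/
noncomputable def Formula.eval {τ : Type u} (I : Interpretation τ) : Formula τ → TruthValue
  | .atom P => I P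
  | .top => 1
  | .bot => -1
  | .defn D => if D.HoldsIn I then 1 else -1
  | .neg φ => -(φ.eval I)
  | .and φ ψ => min (φ.eval I) (ψ.eval I)
  | .or φ ψ => max (φ.eval I) (ψ.eval I)

/-- `I` satisfies (is a model of) `φ`. -/
def Interpretation.Satisfies {τ : Type u} (I : Interpretation τ) (φ : Formula τ) : Prop :=
  I.TwoValued ∧ φ.eval I = 1

/-- Validity of the sequent `Γ → Δ`: every (two-valued) model of all formulas of `Γ` satisfies some
formula of `Δ`. -/
def Valid {τ : Type u} (Γ Δ : Finset (Formula τ)) : Prop :=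
  ∀ I : Interpretation τ, I.TwoValued → (∀ φ ∈ Γ, I.Satisfies φ) → ∃ ψ ∈ Δ, I.Satisfies ψ

/-! ### Renamings used by the definition rules

The vocabulary `τ` enlarged by new atoms is the disjoint sum of `τ` and the type of new atoms. -/

/-- The atoms of `τ` inside an enlarged vocabulary. -/
def old (τ : Type u) (ν : Type v) : τ ↪ τ ⊕ ν := ⟨Sum.inl, Sum.inl_injective⟩

/-- A formula over `τ` as a formula over `τ` enlarged by new atoms. -/
noncomputable def Formula.weaken {τ : Type u} (ν : Type v) (φ : Formula τ) : Formula (τ ⊕ ν) :=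
  φ.lift (old τ ν)

open Classical in
/-- Send each atom `P ∈ S` to the new atom `new P`, and every other atom to itself. -/
noncomputable def renew {τ : Type u} {ν : Type v} (S : Set τ) (new : S ↪ ν) : τ ↪ τ ⊕ ν where
  toFun P := if h : P ∈ S then Sum.inr (new ⟨P, h⟩) else Sum.inl P
  inj' := by
    intro P Q h
    by_cases hP : P ∈ S <;> by_cases hQ : Q ∈ S <;> simp_all

/-- `φ▷`: every positive occurrence of an atom `P ∈ U` is replaced by the new atom `P▷`. -/
noncomputable def PCFormula.tri {τ : Type u} (U : Finset τ) (φ : PCFormula τ) :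
    PCFormula (τ ⊕ (U : Set τ)) :=
  φ.rename (renew (U : Set τ) (Function.Embedding.refl _)) Sum.inl

/-- `D◇`: the rules `P▷ ← φ◇` for the rules `P ← φ` of `D` with `P ∈ V`, where `φ◇` is obtained
from `φ` by replacing each positive occurrence of each `P ∈ V` by `P▷` (the left copy of `V`) and
each negative occurrence of each `P ∈ V` by `P◇` (the right copy of `V`). -/
noncomputable def Definition.diamond {τ : Type u} (D : Definition τ) (V : Finset τ) :
    Definition (τ ⊕ ((V : Set τ) ⊕ (V : Set τ))) :=
  (D.restrict V).rename
    (renew (V : Set τ) ⟨Sum.inl, Sum.inl_injective⟩)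
    (renew (V : Set τ) ⟨Sum.inr, Sum.inr_injective⟩)

/-- `D'`: every occurrence of each defined atom `P` of `D` is replaced by the new atom `P'`. -/
noncomputable def Definition.prime {τ : Type u} (D : Definition τ) :
    Definition (τ ⊕ D.defined) :=
  D.rename (renew D.defined (Function.Embedding.refl _))
    (renew D.defined (Function.Embedding.refl _))

/-! ### The sequent calculus -/

/-- Provability in the sequent calculus for PC(ID): `Provable Γ Δ` says that the sequent `Γ → Δ` is
the root of a proof tree. -/
inductive Provable : {τ : Type u} → Finset (Formula τ) → Finset (Formula τ) → Prop
  -- axioms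
  | ax {τ : Type u} (Γ Δ : Finset (Formula τ)) (A : Formula τ) :
      Provable (insert A Γ) (insert A Δ)
  | ax_bot {τ : Type u} (Δ : Finset (Formula τ)) : Provable {Formula.bot} Δ
  | ax_top {τ : Type u} (Γ : Finset (Formula τ)) : Provable Γ {Formula.top}
  -- structural rules
  | weak_left {τ : Type u} (Γ Δ : Finset (Formula τ)) (A : Formula τ) :
      Provable Γ Δ → Provable (insert A Γ) Δ
  | weak_right {τ : Type u} (Γ Δ : Finset (Formula τ)) (A : Formula τ) :
      Provable Γ Δ → Provable Γ (insert A Δ)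
  | contr_left {τ : Type u} (Γ Δ : Finset (Formula τ)) (A : Formula τ) :
      Provable (insert A (insert A Γ)) Δ → Provable (insert A Γ) Δ
  | contr_right {τ : Type u} (Γ Δ : Finset (Formula τ)) (A : Formula τ) :
      Provable Γ (insert A (insert A Δ)) → Provable Γ (insert A Δ)
  | cut {τ : Type u} (Γ Δ : Finset (Formula τ)) (A : Formula τ) :
      Provable Γ (insert A Δ) → Provable (insert A Γ) Δ → Provable Γ Δ
  -- logical rules
  | neg_left {τ : Type u} (Γ Δ : Finset (Formula τ)) (A : Formula τ) :
      Provable Γ (insert A Δ) → Provable (insert (.neg A) Γ) Δ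
  | neg_right {τ : Type u} (Γ Δ : Finset (Formula τ)) (A : Formula τ) :
      Provable (insert A Γ) Δ → Provable Γ (insert (.neg A) Δ)
  | and_left {τ : Type u} (Γ Δ : Finset (Formula τ)) (A B : Formula τ) :
      Provable (insert A (insert B Γ)) Δ → Provable (insert (.and A B) Γ) Δ
  | and_right {τ : Type u} (Γ Δ : Finset (Formula τ)) (A B : Formula τ) :
      Provable Γ (insert A Δ) → Provable Γ (insert B Δ) → Provable Γ (insert (.and A B) Δ)
  | or_left {τ : Type u} (Γ Δ : Finset (Formula τ)) (A B : Formula τ) :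
      Provable (insert A Γ) Δ → Provable (insert B Γ) Δ → Provable (insert (.or A B) Γ) Δ
  | or_right {τ : Type u} (Γ Δ : Finset (Formula τ)) (A B : Formula τ) :
      Provable Γ (insert A (insert B Δ)) → Provable Γ (insert (.or A B) Δ)
  -- right definition rule for `P`
  | def_right {τ : Type u} (Γ Δ : Finset (Formula τ)) (D : Definition τ) (P : τ)
      (φ : PCFormula τ) (hP : (P, φ) ∈ D.rules) :
      Provable Γ (insert φ.toFormula Δ) →
      Provable (insert (.defn D) Γ) (insert (.atom P) Δ)
  -- left definition rule for `P ∈ U`, with one premise for every `Q ∈ U`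
  | def_left {τ : Type u} (Γ Δ : Finset (Formula τ)) (D : Definition τ) (U : Finset τ)
      (hU : (U : Set τ) ⊆ D.defined) (P : τ) (hP : P ∈ U) :
      (∀ Q ∈ U, ∀ φ, (Q, φ) ∈ D.rules →
        Provable
          ((Finset.univ.image fun R : (U : Set τ) => Formula.neg (.atom (Sum.inr R))) ∪
            Γ.image (Formula.weaken (U : Set τ)))
          (insert (.neg (φ.tri U).toFormula) (Δ.image (Formula.weaken (U : Set τ))))) →
      Provable (insert (.atom P) (insert (.defn D) Γ)) Δ
  -- non-total definition rule for `D`; the list `l` enumerates `V`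
  | non_total {τ : Type u} (Γ Δ : Finset (Formula τ)) (D : Definition τ) (V : Finset τ)
      (hne : V.Nonempty) (hV : (V : Set τ) ⊆ D.defined)
      (l : List (V : Set τ)) (hl : l.Nodup) (hlV : ∀ P, P ∈ l) :
      Provable
        ((Finset.univ.image fun P : (V : Set τ) => Formula.atom (Sum.inr (Sum.inr P))) ∪
          insert (.defn (D.diamond V))
            (Γ.image (Formula.weaken ((V : Set τ) ⊕ (V : Set τ)))))
        (insert (Formula.conj (l.map fun P => Formula.neg (.atom (Sum.inr (Sum.inl P)))))
          (Δ.image (Formula.weaken ((V : Set τ) ⊕ (V : Set τ))))) →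
      Provable
        ((Finset.univ.image fun P : (V : Set τ) => Formula.neg (.atom (Sum.inr (Sum.inr P)))) ∪
          insert (.defn (D.diamond V))
            (Γ.image (Formula.weaken ((V : Set τ) ⊕ (V : Set τ)))))
        (insert (Formula.conj (l.map fun P => Formula.atom (Sum.inr (Sum.inl P))))
          (Δ.image (Formula.weaken ((V : Set τ) ⊕ (V : Set τ))))) →
      Provable (insert (.defn D) Γ) Δ
  -- definition introduction rule for a total definition `D`
  | def_intro {τ : Type u} (Γ Δ : Finset (Formula τ)) (D : Definition τ) (hD : D.Total) :
      (∀ P : D.defined,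
        Provable
          (insert (.defn D.prime) (Γ.image (Formula.weaken D.defined)))
          (insert (Formula.equiv (.atom (Sum.inr P)) (.atom (Sum.inl P.1)))
            (Δ.image (Formula.weaken D.defined)))) →
      Provable Γ (insert (.defn D) Δ)

end PCID

/-!
The proof reduces to one definition and one two-valued interpretation. By cuts on the finitely many
atoms that occur in the sequent, it suffices to prove it with the literals true in a two-valued
interpretation `I` added to the antecedent (`Provable.of_forall_literals`). If `I` falsifies a
formula of `Γ` or satisfies a formula of `Δ`, the propositional rules suffice, since the literals of
a three-valued interpretation decide every PC-formula that has a known value in it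
(`Provable.of_literals`). Otherwise validity yields a definition `D` that is false in `I`, and
the literals of `I` are shown to refute `D` (`Definition.refute`).

Suppose they do not. Then every interpretation reached by a well-founded induction of `D` over the
open part of `I` agrees with `I` on its known atoms: a first disagreement at a true atom is refuted
by the right definition rule, and one at a false atom by the left definition rule. A terminal
well-founded induction exists, so its limit `J` agrees with `I` where it is known, and as `D` is
false in `I`, the set `V` of atoms unknown in `J` is nonempty. The non-total rule for `V` applies:

* When the negative occurrences of `V` are read as true, no rule body is true with the positive
  occurrences read as false, for such a body would be true in `J` already and the induction would
  not be terminal. Hence all of `V` is unfounded, and the left definition rule refutes it.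
* When the negative occurrences of `V` are read as false, let `S ⊆ V` consist of the atoms that are
  provable. If `V \ S` were nonempty, then, since `J` is terminal, it would not be an unfounded set
  for `J`, so some rule body for an atom of `V \ S` is true once `S` is read as true. The right
  definition rule then proves this atom, a contradiction.

In both cases values are compared by monotonicity of the evaluation in the positive occurrences and
antitonicity in the negative ones (`PCFormula.eval_rename_mono`).
-/

namespace PCID

/-! ### Atoms, renaming and evaluation -/

open Classical in
/-- The finite set of atoms occurring in a PC-formula. -/
noncomputable def PCFormula.atoms {τ : Type*} : PCFormula τ → Finset τ
  | .atom P => {P}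
  | .top => ∅
  | .bot => ∅
  | .neg φ => φ.atoms
  | .and φ ψ => φ.atoms ∪ ψ.atoms
  | .or φ ψ => φ.atoms ∪ ψ.atoms

open Classical in
/-- The finite set of atoms occurring in a definition, as a head or in a body. -/
noncomputable def Definition.atoms {τ : Type*} (D : Definition τ) : Finset τ :=
  D.rules.biUnion fun r => insert r.1 r.2.atoms

theorem Definition.mem_atoms {τ : Type*} {D : Definition τ} {Q : τ} :
    Q ∈ D.atoms ↔ ∃ P φ, (P, φ) ∈ D.rules ∧ (Q = P ∨ Q ∈ φ.atoms) := by
  simp [atoms]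

theorem Definition.head_mem_atoms {τ : Type*} {D : Definition τ} {P : τ} {φ : PCFormula τ}
    (h : (P, φ) ∈ D.rules) : P ∈ D.atoms :=
  mem_atoms.2 ⟨P, φ, h, Or.inl rfl⟩

theorem Definition.body_atoms_subset {τ : Type*} {D : Definition τ} {P : τ} {φ : PCFormula τ}
    (h : (P, φ) ∈ D.rules) : φ.atoms ⊆ D.atoms :=
  fun _ hQ => mem_atoms.2 ⟨P, φ, h, Or.inr hQ⟩

theorem Definition.defined_finite {τ : Type*} (D : Definition τ) : D.defined.Finite :=
  D.atoms.finite_toSet.subset fun _ ⟨_, h⟩ => D.head_mem_atoms h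

theorem PCFormula.mem_atoms_rename {τ σ : Type*} {p n : τ → σ} {φ : PCFormula τ} {Q : σ}
    (h : Q ∈ (φ.rename p n).atoms) : ∃ P ∈ φ.atoms, Q = p P ∨ Q = n P := by
  induction φ generalizing p n with
  | atom P =>
    simp only [rename, atoms, Finset.mem_singleton] at h
    exact ⟨P, by simp [atoms], Or.inl h⟩
  | top => simp [rename, atoms] at h
  | bot => simp [rename, atoms] at h
  | neg φ ih =>
    obtain ⟨P, hP, h⟩ := ih (p := n) (n := p) h
    exact ⟨P, hP, h.symm⟩
  | and φ ψ ih₁ ih₂ | or φ ψ ih₁ ih₂ =>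
    simp only [rename, atoms, Finset.mem_union] at h ⊢
    rcases h with h | h
    · obtain ⟨P, hP, h⟩ := ih₁ h
      exact ⟨P, Or.inl hP, h⟩
    · obtain ⟨P, hP, h⟩ := ih₂ h
      exact ⟨P, Or.inr hP, h⟩

theorem PCFormula.rename_rename {τ σ ρ : Type*} (p n : τ → σ) (p' n' : σ → ρ)
    (φ : PCFormula τ) : (φ.rename p n).rename p' n' = φ.rename (p' ∘ p) (n' ∘ n) := by
  induction φ generalizing p n p' n' <;> simp_all [rename]

theorem PCFormula.rename_id {τ : Type*} (φ : PCFormula τ) : φ.rename id id = φ := by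
  induction φ <;> simp_all [rename]

/-- Evaluation is monotone in the positive and antitone in the negative occurrences of atoms. -/
theorem PCFormula.eval_rename_mono.{w, z} {τ : Type w} {σ ρ : Type z} {p n : τ → σ} {p' n' : τ → ρ}
    {K : Interpretation σ} {L : Interpretation ρ} (φ : PCFormula τ)
    (hp : ∀ P, K (p P) ≤ L (p' P)) (hn : ∀ P, L (n' P) ≤ K (n P)) :
    (φ.rename p n).eval K ≤ (φ.rename p' n').eval L := by
  induction φ generalizing σ ρ with
  | atom P => exact hp P
  | top => exact le_rfl
  | bot => exact le_rfl
  | neg φ ih =>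
    have neg_le : ∀ a b : SignType, a ≤ b → -b ≤ -a := by decide
    exact neg_le _ _ (ih hn hp)
  | and φ ψ ih₁ ih₂ => exact min_le_min (ih₁ hp hn) (ih₂ hp hn)
  | or φ ψ ih₁ ih₂ => exact max_le_max (ih₁ hp hn) (ih₂ hp hn)

theorem PCFormula.eval_ne_zero {τ : Type*} {K : Interpretation τ} (φ : PCFormula τ)
    (h : ∀ P ∈ φ.atoms, K P ≠ 0) : φ.eval K ≠ 0 := by
  induction φ with
  | atom P => exact h P (by simp [atoms])
  | top => simp [eval]
  | bot => simp [eval]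
  | neg φ ih =>
    have neg_ne : ∀ a : SignType, a ≠ 0 → -a ≠ 0 := by decide
    exact neg_ne _ (ih h)
  | and φ ψ ih₁ ih₂ =>
    simp only [atoms, Finset.mem_union] at h
    have min_ne : ∀ a b : SignType, a ≠ 0 → b ≠ 0 → min a b ≠ 0 := by decide
    exact min_ne _ _ (ih₁ fun P hP => h P (Or.inl hP)) (ih₂ fun P hP => h P (Or.inr hP))
  | or φ ψ ih₁ ih₂ =>
    simp only [atoms, Finset.mem_union] at h
    have max_ne : ∀ a b : SignType, a ≠ 0 → b ≠ 0 → max a b ≠ 0 := by decide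
    exact max_ne _ _ (ih₁ fun P hP => h P (Or.inl hP)) (ih₂ fun P hP => h P (Or.inr hP))

theorem PCFormula.eval_toFormula {τ : Type*} (I : Interpretation τ) (φ : PCFormula τ) :
    φ.toFormula.eval I = φ.eval I := by
  induction φ <;> simp_all [toFormula, Formula.eval, eval]

theorem TruthValue.eq_neg_one {a : TruthValue} (h₀ : a ≠ 0) (h₁ : a ≠ 1) : a = -1 := by
  revert a; decide

theorem TruthValue.eq_one {a : TruthValue} (h₀ : a ≠ 0) (h₁ : a ≠ -1) : a = 1 := by
  revert a; decide

/-! ### Propositional reasoning -/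

theorem Provable.mono_left {τ : Type*} {Γ Γ' Δ : Finset (Formula τ)} (h : Provable Γ Δ)
    (hΓ : Γ ⊆ Γ') : Provable Γ' Δ := by
  have key : ∀ s : Finset (Formula τ), Provable (s ∪ Γ) Δ := by
    intro s
    induction s using Finset.induction_on with
    | empty => simpa using h
    | insert A s _ ih => rw [Finset.insert_union]; exact .weak_left _ _ _ ih
  simpa [Finset.union_eq_left.2 hΓ] using key Γ'

theorem Provable.mono_right {τ : Type*} {Γ Δ Δ' : Finset (Formula τ)} (h : Provable Γ Δ)
    (hΔ : Δ ⊆ Δ') : Provable Γ Δ' := by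
  have key : ∀ s : Finset (Formula τ), Provable Γ (s ∪ Δ) := by
    intro s
    induction s using Finset.induction_on with
    | empty => simpa using h
    | insert A s _ ih => rw [Finset.insert_union]; exact .weak_right _ _ _ ih
  simpa [Finset.union_eq_left.2 hΔ] using key Δ'

theorem Provable.of_mem {τ : Type*} {Γ Δ : Finset (Formula τ)} {A : Formula τ} (hΓ : A ∈ Γ)
    (hΔ : A ∈ Δ) : Provable Γ Δ := by
  simpa [Finset.insert_eq_of_mem hΓ, Finset.insert_eq_of_mem hΔ] using Provable.ax Γ Δ A

theorem Provable.of_neg_mem {τ : Type*} {Γ Δ : Finset (Formula τ)} {A : Formula τ}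
    (h : Formula.neg A ∈ Γ) (hA : Provable Γ (insert A Δ)) : Provable Γ Δ := by
  simpa [Finset.insert_eq_of_mem h] using Provable.neg_left Γ Δ A hA

theorem Provable.conj_right {τ : Type*} {Γ Δ : Finset (Formula τ)} (l : List (Formula τ))
    (h : ∀ F ∈ l, Provable Γ (insert F Δ)) : Provable Γ (insert (Formula.conj l) Δ) := by
  induction l with
  | nil => exact (Provable.ax_top Γ).mono_right (by simp [Formula.conj])
  | cons F l ih =>
    cases l with
    | nil => exact h F (by simp)
    | cons G l =>
      exact .and_right _ _ _ _ (h F (by simp)) (ih fun F' hF' => h F' (List.mem_cons_of_mem _ hF'))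

/-- If `Γ` proves the true and refutes the false atoms of `φ`, then it proves `φ` when `φ` is true
and refutes it when `φ` is false; atoms with value unknown may occur. -/
theorem Provable.of_literals {τ : Type*} {Γ Δ : Finset (Formula τ)} {K : Interpretation τ}
    (φ : PCFormula τ)
    (ht : ∀ P ∈ φ.atoms, K P = 1 → Provable Γ (insert (.atom P) Δ))
    (hf : ∀ P ∈ φ.atoms, K P = -1 → Provable (insert (.atom P) Γ) Δ) :
    (φ.eval K = 1 → Provable Γ (insert φ.toFormula Δ)) ∧
      (φ.eval K = -1 → Provable (insert φ.toFormula Γ) Δ) := by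
  induction φ with
  | atom P => exact ⟨ht P (by simp [PCFormula.atoms]), hf P (by simp [PCFormula.atoms])⟩
  | top =>
    exact ⟨fun _ => (Provable.ax_top Γ).mono_right (by simp [PCFormula.toFormula]),
      fun h => absurd (show (1 : SignType) = -1 from h) (by decide)⟩
  | bot =>
    exact ⟨fun h => absurd (show (-1 : SignType) = 1 from h) (by decide),
      fun _ => (Provable.ax_bot Δ).mono_left (by simp [PCFormula.toFormula])⟩
  | neg φ ih =>
    obtain ⟨h₁, h₂⟩ := ih ht hf
    have neg_one : ∀ a : SignType, -a = 1 → a = -1 := by decide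
    have neg_neg_one : ∀ a : SignType, -a = -1 → a = 1 := by decide
    exact ⟨fun h => .neg_right _ _ _ (h₂ (neg_one _ h)),
      fun h => .neg_left _ _ _ (h₁ (neg_neg_one _ h))⟩
  | and φ ψ ih₁ ih₂ =>
    simp only [PCFormula.atoms, Finset.mem_union] at ht hf
    obtain ⟨t₁, f₁⟩ := ih₁ (fun P hP => ht P (Or.inl hP)) (fun P hP => hf P (Or.inl hP))
    obtain ⟨t₂, f₂⟩ := ih₂ (fun P hP => ht P (Or.inr hP)) (fun P hP => hf P (Or.inr hP))
    have min_one : ∀ a b : SignType, min a b = 1 → a = 1 ∧ b = 1 := by decide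
    have min_neg_one : ∀ a b : SignType, min a b = -1 → a = -1 ∨ b = -1 := by decide
    refine ⟨fun h => ?_, fun h => .and_left _ _ _ _ ?_⟩
    · exact .and_right _ _ _ _ (t₁ (min_one _ _ h).1) (t₂ (min_one _ _ h).2)
    · rcases min_neg_one _ _ h with h | h
      · exact (f₁ h).mono_left (Finset.insert_subset_insert _ (Finset.subset_insert _ _))
      · exact (f₂ h).mono_left (Finset.subset_insert _ _)
  | or φ ψ ih₁ ih₂ =>
    simp only [PCFormula.atoms, Finset.mem_union] at ht hf
    obtain ⟨t₁, f₁⟩ := ih₁ (fun P hP => ht P (Or.inl hP)) (fun P hP => hf P (Or.inl hP))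
    obtain ⟨t₂, f₂⟩ := ih₂ (fun P hP => ht P (Or.inr hP)) (fun P hP => hf P (Or.inr hP))
    have max_one : ∀ a b : SignType, max a b = 1 → a = 1 ∨ b = 1 := by decide
    have max_neg_one : ∀ a b : SignType, max a b = -1 → a = -1 ∧ b = -1 := by decide
    refine ⟨fun h => .or_right _ _ _ _ ?_, fun h => ?_⟩
    · rcases max_one _ _ h with h | h
      · exact (t₁ h).mono_right (Finset.insert_subset_insert _ (Finset.subset_insert _ _))
      · exact (t₂ h).mono_right (Finset.subset_insert _ _)
    · exact .or_left _ _ _ _ (f₁ (max_neg_one _ _ h).1) (f₂ (max_neg_one _ _ h).2)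

/-- The set of those literals over the atoms in `A` that are true in the two-valued
interpretation `I`. -/
noncomputable def literals {τ : Type*} (I : Interpretation τ) (A : Finset τ) :
    Finset (Formula τ) :=
  A.image fun P => if I P = 1 then .atom P else .neg (.atom P)

theorem atom_mem_literals {τ : Type*} {I : Interpretation τ} {A : Finset τ} {P : τ}
    (hP : P ∈ A) (h : I P = 1) : Formula.atom P ∈ literals I A :=
  Finset.mem_image.2 ⟨P, hP, by simp [h]⟩

theorem neg_atom_mem_literals {τ : Type*} {I : Interpretation τ} {A : Finset τ} {P : τ}
    (hP : P ∈ A) (h : I P = -1) : Formula.neg (.atom P) ∈ literals I A :=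
  Finset.mem_image.2 ⟨P, hP, by simp [h]⟩

/-- Case distinction on the atoms in `A`, by cuts. -/
theorem Provable.of_forall_literals {τ : Type*} {Γ Δ : Finset (Formula τ)} (A : Finset τ)
    (h : ∀ I : Interpretation τ, I.TwoValued → Provable (literals I A ∪ Γ) Δ) : Provable Γ Δ := by
  classical
  induction A using Finset.induction_on generalizing Γ with
  | empty => simpa [literals] using h (fun _ => 1) (fun _ => one_ne_zero)
  | insert P A hPA ih =>
    have key : ∀ I : Interpretation τ, I.TwoValued → ∀ v : TruthValue, v ≠ 0 →
        Provable (insert (if v = 1 then .atom P else .neg (.atom P)) (literals I A ∪ Γ)) Δ := by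
      intro I hI v hv
      have := h (Function.update I P v) (fun Q => by
        by_cases hQ : Q = P
        · subst hQ; simpa using hv
        · simpa [hQ] using hI Q)
      have e : literals (Function.update I P v) A = literals I A :=
        Finset.image_congr fun Q hQ => by
          have : Q ≠ P := fun e => hPA (e ▸ hQ)
          simp [this]
      have e' : literals (Function.update I P v) (insert P A) =
          insert (if v = 1 then .atom P else .neg (.atom P)) (literals I A) := by
        rw [← e, literals, Finset.image_insert]
        simp [literals]
      rwa [e', Finset.insert_union] at this
    refine ih fun I hI => .cut _ _ (.neg (.atom P)) ?_ ?_
    · exact .neg_right _ _ _ (by simpa using key I hI 1 (by decide))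
    · simpa using key I hI (-1) (by decide)

/-! ### Well-founded inductions -/

theorem Definition.Step.eq_of_notMem_defined {τ : Type*} {D : Definition τ}
    {J J' : Interpretation τ} (h : D.Step J J') {P : τ} (hP : P ∉ D.defined) : J' P = J P := by
  cases h with
  | derive_true Q φ hQ hr hφ =>
    have : P ≠ Q := fun e => hP ⟨φ, e ▸ hr⟩
    simp [Interpretation.update, this]
  | derive_false U hne hU hu hφ =>
    have : P ∉ U := fun e => hP (hU e)
    simp [Interpretation.update, this]

theorem Definition.eq_of_notMem_defined {τ : Type*} {D : Definition τ} {I J : Interpretation τ}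
    (h : Relation.ReflTransGen D.Step (I.update D.defined 0) J) {P : τ} (hP : P ∉ D.defined) :
    J P = I P := by
  induction h with
  | refl => simp [Interpretation.update, hP]
  | tail _ hs ih => rw [hs.eq_of_notMem_defined hP, ih]

theorem Definition.Step.ncard_lt {τ : Type*} {D : Definition τ} {J J' : Interpretation τ}
    (h : D.Step J J') :
    {P ∈ D.defined | J' P = 0}.ncard < {P ∈ D.defined | J P = 0}.ncard := by
  refine Set.ncard_lt_ncard ?_ (D.defined_finite.subset (Set.sep_subset _ _))
  rw [Set.ssubset_iff_exists]
  cases h with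
  | derive_true Q φ hQ hr hφ =>
    refine ⟨fun P ⟨hP, h⟩ => ⟨hP, ?_⟩, Q, ⟨⟨φ, hr⟩, hQ⟩, by simp [Interpretation.update]⟩
    by_cases e : P = Q
    · rw [e, hQ]
    · simpa [Interpretation.update, e] using h
  | derive_false U hne hU hu hφ =>
    obtain ⟨Q, hQ⟩ := hne
    refine ⟨fun P ⟨hP, h⟩ => ⟨hP, ?_⟩, Q, ⟨hU hQ, hu Q hQ⟩, by simp [Interpretation.update, hQ]⟩
    by_cases e : P ∈ U
    · exact hu P e
    · simpa [Interpretation.update, e] using h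

/-- Every definition has a terminal well-founded induction. -/
theorem Definition.exists_isWellFoundedLimit {τ : Type*} (D : Definition τ)
    (I : Interpretation τ) : ∃ J, D.IsWellFoundedLimit I J := by
  obtain ⟨J, hJ, hmin⟩ := (measure fun J : Interpretation τ =>
    {P ∈ D.defined | J P = 0}.ncard).wf.has_min
      {J | Relation.ReflTransGen D.Step (I.update D.defined 0) J} ⟨_, .refl⟩
  exact ⟨J, hJ, fun J' hs => hmin J' (.tail hJ hs) hs.ncard_lt⟩

/-! ### Refuting a definition -/

theorem weaken_atom_mem {τ ν : Type*} {Γ : Finset (Formula τ)} {P : τ}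
    (h : Formula.atom P ∈ Γ) : Formula.atom (Sum.inl P) ∈ Γ.image (Formula.weaken ν) :=
  Finset.mem_image.2 ⟨_, h, rfl⟩

theorem weaken_neg_atom_mem {τ ν : Type*} {Γ : Finset (Formula τ)} {P : τ}
    (h : Formula.neg (.atom P) ∈ Γ) :
    Formula.neg (.atom (Sum.inl P)) ∈ Γ.image (Formula.weaken ν) :=
  Finset.mem_image.2 ⟨_, h, rfl⟩

theorem renew_of_mem {τ ν : Type*} {S : Set τ} (new : S ↪ ν) {P : τ} (h : P ∈ S) :
    renew S new P = Sum.inr (new ⟨P, h⟩) := dif_pos h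

theorem renew_of_notMem {τ ν : Type*} {S : Set τ} (new : S ↪ ν) {P : τ} (h : P ∉ S) :
    renew S new P = Sum.inl P := dif_neg h

theorem PCFormula.mem_atoms_of_mem_tri {τ : Type*} {U : Finset τ} {φ : PCFormula τ} {R : τ}
    (hR : Sum.inl R ∈ (φ.tri U).atoms) : R ∈ φ.atoms := by
  obtain ⟨S, hS, e⟩ := mem_atoms_rename hR
  rcases e with e | e
  · by_cases hSU : S ∈ (U : Set τ)
    · rw [renew_of_mem _ hSU] at e; cases e
    · rw [renew_of_notMem _ hSU] at e; exact Sum.inl_injective e ▸ hS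
  · exact Sum.inl_injective e ▸ hS

/-- The left definition rule as used below: if `Γ` contains the literals known in `K`, and every
body `φ▷` of a rule with head in `U` is false in `K` with all new atoms `Q▷` false, then `D` and `Γ`
refute every atom of `U`. -/
theorem Provable.unfounded {τ : Type*} {D : Definition τ} {Γ Δ : Finset (Formula τ)}
    {U : Finset τ} {K : Interpretation τ} (hU : (U : Set τ) ⊆ D.defined)
    (ht : ∀ P ∈ D.atoms, K P = 1 → Formula.atom P ∈ Γ)
    (hf : ∀ P ∈ D.atoms, K P = -1 → Formula.neg (.atom P) ∈ Γ)
    (hbody : ∀ Q ∈ U, ∀ φ, (Q, φ) ∈ D.rules →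
      (φ.tri U).eval (Sum.elim K fun _ => -1) = -1)
    {P : τ} (hP : P ∈ U) : Provable (insert (.atom P) (insert (.defn D) Γ)) Δ := by
  refine .def_left _ _ D U hU P hP fun Q hQ φ hr => .neg_right _ _ _ ?_
  refine (Provable.of_literals (K := Sum.elim K fun _ => -1) (φ.tri U) ?_ ?_).2
    (hbody Q hQ φ hr)
  · rintro (R | R) hR h
    · exact .of_mem (Finset.mem_union_right _ (weaken_atom_mem
        (ht R (Definition.body_atoms_subset hr (PCFormula.mem_atoms_of_mem_tri hR)) h)))
        (Finset.mem_insert_self _ _)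
    · exact absurd (show (-1 : SignType) = 1 from h) (by decide)
  · rintro (R | R) hR h
    · refine .of_neg_mem (Finset.mem_insert_of_mem (Finset.mem_union_right _ (weaken_neg_atom_mem
        (hf R (Definition.body_atoms_subset hr (PCFormula.mem_atoms_of_mem_tri hR)) h)))) ?_
      exact .of_mem (Finset.mem_insert_self _ _) (Finset.mem_insert_self _ _)
    · refine .of_neg_mem (A := .atom (Sum.inr R)) (Finset.mem_insert_of_mem
        (Finset.mem_union_left _ (Finset.mem_image_of_mem _ (Finset.mem_univ R)))) ?_
      exact .of_mem (Finset.mem_insert_self _ _) (Finset.mem_insert_self _ _)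

/-- A step of a well-founded induction that starts in agreement with `I` and leads to a
disagreement yields a refutation of `D` from the literals of `I`. -/
theorem Definition.Step.provable_of_ne {τ : Type*} {D : Definition τ} {I J J' : Interpretation τ}
    {A : Finset τ} (hA : D.atoms ⊆ A) (hI : I.TwoValued) (hJ : ∀ P, J P ≠ 0 → J P = I P)
    (hs : D.Step J J') {P : τ} (hP : J' P ≠ 0) (hne : J' P ≠ I P) :
    Provable (insert (.defn D) (literals I A)) ∅ := by
  have agree : ∀ P v, v ≠ 0 → J P = v → I P = v := fun P v hv h => by rw [← hJ P (h ▸ hv), h]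
  cases hs with
  | derive_true Q φ hQ hr hφ =>
    have hPQ : P = Q := by
      by_contra e
      simp only [Interpretation.update, Set.mem_singleton_iff, e, if_false] at hP hne
      exact hne (hJ P hP)
    subst hPQ
    have hIP : I P = -1 := TruthValue.eq_neg_one (hI P)
      fun e => hne (by simp [Interpretation.update, e])
    refine .of_neg_mem (A := .atom P) (Finset.mem_insert_of_mem
      (neg_atom_mem_literals (hA (D.head_mem_atoms hr)) hIP)) ?_
    refine .def_right _ _ D P φ hr ((Provable.of_literals φ (fun R hR h => ?_)
      fun R hR h => ?_).1 hφ)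
    · exact .of_mem (atom_mem_literals (hA (body_atoms_subset hr hR)) (agree R 1 (by decide) h))
        (Finset.mem_insert_self _ _)
    · refine .of_neg_mem (Finset.mem_insert_of_mem (neg_atom_mem_literals
        (hA (body_atoms_subset hr hR)) (agree R (-1) (by decide) h))) ?_
      exact .of_mem (Finset.mem_insert_self _ _) (Finset.mem_insert_self _ _)
  | derive_false U hne' hU hu hφ =>
    have hPU : P ∈ U := by
      by_contra e
      simp only [Interpretation.update, e, if_false] at hP hne
      exact hne (hJ P hP)
    have hIP : I P = 1 := TruthValue.eq_one (hI P)
      fun e => hne (by simp [Interpretation.update, hPU, e])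
    obtain ⟨φP, hrP⟩ := hU hPU
    lift U to Finset τ using D.defined_finite.subset hU
    have := Provable.unfounded (Γ := literals I A) (Δ := ∅) (K := J) hU
      (fun R hR h => atom_mem_literals (hA hR) (agree R 1 (by decide) h))
      (fun R hR h => neg_atom_mem_literals (hA hR) (agree R (-1) (by decide) h))
      (fun Q hQ φ hr => ?_) hPU
    · rwa [Finset.insert_eq_of_mem (Finset.mem_insert_of_mem
        (atom_mem_literals (hA (D.head_mem_atoms hrP)) hIP))] at this
    · -- negative occurrences of `U` are unknown here and false in `J[U/f]`, which only lowers
      -- the value of the body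
      have : (φ.tri U).eval (Sum.elim J fun _ => -1) ≤ -1 := by
        refine le_of_le_of_eq ?_ (hφ Q hQ φ hr)
        conv_rhs => rw [← φ.rename_id]
        refine φ.eval_rename_mono (fun R => ?_) fun R => ?_
        · by_cases hR : R ∈ (U : Set τ)
          · rw [renew_of_mem _ hR]; exact SignType.neg_one_le (J.update U (-1) R)
          · rw [renew_of_notMem _ hR]; simp [Interpretation.update, Finset.mem_coe.not.1 hR]
        · by_cases hR : R ∈ U
          · simp [Interpretation.update, hR]
          · simp [Interpretation.update, hR]
      exact le_antisymm this (SignType.neg_one_le _)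

theorem Definition.mem_diamond_rules {τ : Type*} {D : Definition τ} {V : Finset τ}
    {Q : τ ⊕ ((V : Set τ) ⊕ (V : Set τ))} {ψ : PCFormula (τ ⊕ ((V : Set τ) ⊕ (V : Set τ)))} :
    (Q, ψ) ∈ (D.diamond V).rules ↔ ∃ P φ, (P, φ) ∈ D.rules ∧ ∃ h : P ∈ V,
      Q = Sum.inr (Sum.inl ⟨P, h⟩) ∧
      ψ = φ.rename (renew (V : Set τ) ⟨Sum.inl, Sum.inl_injective⟩)
        (renew (V : Set τ) ⟨Sum.inr, Sum.inr_injective⟩) := by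
  -- the decidability instance in `Definition.rename` is the classical one, hence `(_)`
  classical
  constructor
  · intro h
    obtain ⟨⟨P, φ⟩, hr, e⟩ := (@Finset.mem_image _ _ (_) _ _ _).1 h
    obtain ⟨hr, hP⟩ := Finset.mem_filter.1 hr
    obtain ⟨rfl, rfl⟩ := Prod.mk.inj e
    exact ⟨P, φ, hr, hP, renew_of_mem _ (Finset.mem_coe.2 hP), rfl⟩
  · rintro ⟨P, φ, hr, hP, rfl, rfl⟩
    exact (@Finset.mem_image _ _ (_) _ _ _).2 ⟨(P, φ), Finset.mem_filter.2 ⟨hr, hP⟩,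
      Prod.ext (renew_of_mem _ (Finset.mem_coe.2 hP)) rfl⟩

/-- An old atom of `D◇` occurs in `D`. -/
theorem Definition.mem_atoms_of_mem_diamond_body {τ : Type*} {D : Definition τ} {V : Finset τ}
    {P R : τ} {φ : PCFormula τ} (hr : (P, φ) ∈ D.rules)
    (hR : (Sum.inl R : τ ⊕ ((V : Set τ) ⊕ (V : Set τ))) ∈
      (φ.rename (renew (V : Set τ) ⟨Sum.inl, Sum.inl_injective⟩)
        (renew (V : Set τ) ⟨Sum.inr, Sum.inr_injective⟩)).atoms) : R ∈ D.atoms := by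
  obtain ⟨S, hS, e⟩ := PCFormula.mem_atoms_rename hR
  by_cases hSV : S ∈ (V : Set τ)
  · rw [renew_of_mem _ hSV, renew_of_mem _ hSV] at e
    rcases e with e | e <;> cases e
  · rw [renew_of_notMem _ hSV, renew_of_notMem _ hSV, or_self] at e
    exact Sum.inl_injective e ▸ body_atoms_subset hr hS

theorem Definition.mem_atoms_of_mem_diamond_atoms {τ : Type*} {D : Definition τ} {V : Finset τ}
    {R : τ} (hR : (Sum.inl R : τ ⊕ ((V : Set τ) ⊕ (V : Set τ))) ∈ (D.diamond V).atoms) :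
    R ∈ D.atoms := by
  obtain ⟨Q, ψ, hψ, hR⟩ := mem_atoms.1 hR
  obtain ⟨P, φ, hr, hP, rfl, rfl⟩ := mem_diamond_rules.1 hψ
  rcases hR with e | hR
  · cases e
  · exact mem_atoms_of_mem_diamond_body hr hR

/-- The first premise of the non-total rule: when the negative occurrences of the unknown atoms
are read as true, `D◇` makes all of these atoms false. -/
theorem Definition.diamond_refutes {τ : Type*} {D : Definition τ} {I J : Interpretation τ}
    {A : Finset τ} (hA : D.atoms ⊆ A) (hJ : ∀ P, J P ≠ 0 → J P = I P)
    (hterm : ∀ J', ¬ D.Step J J') {V : Finset τ} (hV : ∀ P, P ∈ V ↔ J P = 0)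
    (hVD : (V : Set τ) ⊆ D.defined) (P : (V : Set τ)) :
    Provable ((Finset.univ.image fun P : (V : Set τ) => Formula.atom (Sum.inr (Sum.inr P))) ∪
      insert (.defn (D.diamond V))
        ((literals I A).image (Formula.weaken ((V : Set τ) ⊕ (V : Set τ)))))
      {Formula.neg (.atom (Sum.inr (Sum.inl P)))} := by
  classical
  let K : Interpretation (τ ⊕ ((V : Set τ) ⊕ (V : Set τ))) :=
    Sum.elim J (Sum.elim (fun _ => 0) fun _ => 1)
  let U : Finset (τ ⊕ ((V : Set τ) ⊕ (V : Set τ))) :=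
    Finset.univ.image fun P : (V : Set τ) => Sum.inr (Sum.inl P)
  have inl_notMem : ∀ R : τ, Sum.inl R ∉ (U : Set (τ ⊕ ((V : Set τ) ⊕ (V : Set τ)))) := by
    simp [U]
  have mem_U : ∀ R : (V : Set τ),
      Sum.inr (Sum.inl R) ∈ (U : Set (τ ⊕ ((V : Set τ) ⊕ (V : Set τ)))) := by
    simp [U]
  rw [← insert_empty_eq]
  refine .neg_right _ _ _ ((Provable.unfounded (D := D.diamond V) (U := U) (K := K)
    (Γ := (Finset.univ.image fun P : (V : Set τ) => Formula.atom (Sum.inr (Sum.inr P))) ∪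
      (literals I A).image (Formula.weaken ((V : Set τ) ⊕ (V : Set τ))))
    ?_ ?_ ?_ ?_ (mem_U P)).mono_left ?_)
  · intro Q hQ
    obtain ⟨R, -, rfl⟩ := Finset.mem_image.1 (Finset.mem_coe.1 hQ)
    obtain ⟨φ, hφ⟩ := hVD R.2
    exact ⟨_, mem_diamond_rules.2 ⟨R, φ, hφ, R.2, rfl, rfl⟩⟩
  · rintro (R | R | R) hR h
    · have h : J R = 1 := h
      exact Finset.mem_union_right _ (weaken_atom_mem (atom_mem_literals
        (hA (mem_atoms_of_mem_diamond_atoms hR)) (by rw [← hJ R (by simp [h]), h])))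
    · exact absurd (show (0 : SignType) = 1 from h) (by decide)
    · exact Finset.mem_union_left _ (Finset.mem_image_of_mem _ (Finset.mem_univ R))
  · rintro (R | R | R) hR h
    · have h : J R = -1 := h
      exact Finset.mem_union_right _ (weaken_neg_atom_mem (neg_atom_mem_literals
        (hA (mem_atoms_of_mem_diamond_atoms hR)) (by rw [← hJ R (by simp [h]), h])))
    · exact absurd (show (0 : SignType) = -1 from h) (by decide)
    · exact absurd (show (1 : SignType) = -1 from h) (by decide)
  · intro Q hQ ψ hψ
    obtain ⟨R, φ, hr, hR, rfl, rfl⟩ := mem_diamond_rules.1 hψ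
    have hpos : ∀ S, Sum.elim K (fun _ => -1)
        (renew (U : Set (τ ⊕ ((V : Set τ) ⊕ (V : Set τ)))) (Function.Embedding.refl _)
          (renew (V : Set τ) ⟨Sum.inl, Sum.inl_injective⟩ S)) =
        if S ∈ V then -1 else J S := by
      intro S
      by_cases hS : S ∈ V
      · rw [renew_of_mem _ (Finset.mem_coe.2 hS), if_pos hS]
        exact congrArg (Sum.elim K fun _ => -1)
          (renew_of_mem (Function.Embedding.refl _) (mem_U ⟨S, hS⟩))
      · have hS' : S ∉ (V : Set τ) := hS
        rw [renew_of_notMem _ hS', if_neg hS, renew_of_notMem _ (inl_notMem S)]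
        rfl
    have hneg : ∀ S, K (renew (V : Set τ) ⟨Sum.inr, Sum.inr_injective⟩ S) =
        if S ∈ V then 1 else J S := by
      intro S
      by_cases hS : S ∈ V
      · rw [renew_of_mem _ (Finset.mem_coe.2 hS), if_pos hS]; rfl
      · rw [renew_of_notMem _ (by simpa using hS), if_neg hS]; rfl
    rw [PCFormula.tri, PCFormula.rename_rename]
    refine TruthValue.eq_neg_one (PCFormula.eval_ne_zero _ fun T hT => ?_) fun h => ?_
    · obtain ⟨S, hS, rfl | rfl⟩ := PCFormula.mem_atoms_rename hT
      · rw [Function.comp_apply, hpos]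
        split_ifs with hSV
        · decide
        · exact fun e => hSV ((hV S).2 e)
      · rw [Function.comp_apply, Sum.elim_inl, hneg]
        split_ifs with hSV
        · decide
        · exact fun e => hSV ((hV S).2 e)
    · -- a body true in this reading would be true in `J`
      refine hterm _ (.derive_true J R φ ((hV R).1 hR) hr (le_antisymm (SignType.le_one _) ?_))
      rw [← h]
      conv_rhs => rw [← φ.rename_id]
      refine φ.eval_rename_mono (fun S => ?_) fun S => ?_
      · rw [Function.comp_apply, hpos]
        split_ifs
        · exact SignType.neg_one_le (J S)
        · exact le_rfl
      · rw [Function.comp_apply, Sum.elim_inl, hneg]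
        split_ifs
        · exact SignType.le_one (J S)
        · exact le_rfl
  · intro F hF
    simp only [Finset.mem_insert, Finset.mem_union] at hF ⊢
    tauto

/-- The second premise of the non-total rule: when the negative occurrences of the unknown atoms
are read as false, `D◇` makes all of these atoms true. -/
theorem Definition.diamond_proves {τ : Type*} {D : Definition τ} {I J : Interpretation τ}
    {A : Finset τ} (hA : D.atoms ⊆ A) (hJ : ∀ P, J P ≠ 0 → J P = I P)
    (hterm : ∀ J', ¬ D.Step J J') {V : Finset τ} (hV : ∀ P, P ∈ V ↔ J P = 0)
    (hVD : (V : Set τ) ⊆ D.defined) (P : (V : Set τ)) :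
    Provable
      ((Finset.univ.image fun P : (V : Set τ) => Formula.neg (.atom (Sum.inr (Sum.inr P)))) ∪
        insert (.defn (D.diamond V))
          ((literals I A).image (Formula.weaken ((V : Set τ) ⊕ (V : Set τ)))))
      {Formula.atom (Sum.inr (Sum.inl P))} := by
  classical
  by_contra hP
  set Θ := (Finset.univ.image fun P : (V : Set τ) =>
      (Formula.neg (.atom (Sum.inr (Sum.inr P))) : Formula (τ ⊕ ((V : Set τ) ⊕ (V : Set τ))))) ∪
    insert (.defn (D.diamond V))
      ((literals I A).image (Formula.weaken ((V : Set τ) ⊕ (V : Set τ))))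
  let U : Set τ := {Q | ∃ h : Q ∈ V, ¬ Provable Θ {Formula.atom (Sum.inr (Sum.inl ⟨Q, h⟩))}}
  -- `U` is not an unfounded set for `J`
  obtain ⟨R, ⟨hRV, hR⟩, φ, hr, hφ⟩ : ∃ R ∈ U, ∃ φ, (R, φ) ∈ D.rules ∧
      φ.eval (J.update U (-1)) ≠ -1 := by
    by_contra hall
    push Not at hall
    exact hterm _ (.derive_false J U ⟨P, P.2, hP⟩ (fun Q hQ => hVD hQ.1)
      (fun Q hQ => (hV Q).1 hQ.1) hall)
  refine hR ?_
  -- the provable atoms are true, and the atoms in `U` have the value `v`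
  let K (v : TruthValue) : Interpretation (τ ⊕ ((V : Set τ) ⊕ (V : Set τ))) :=
    Sum.elim J (Sum.elim (fun Q => if Q.1 ∈ U then v else 1) fun _ => -1)
  let p : τ ↪ τ ⊕ ((V : Set τ) ⊕ (V : Set τ)) :=
    renew (V : Set τ) ⟨Sum.inl, Sum.inl_injective⟩
  let q : τ ↪ τ ⊕ ((V : Set τ) ⊕ (V : Set τ)) :=
    renew (V : Set τ) ⟨Sum.inr, Sum.inr_injective⟩
  have hpos : ∀ v S, K v (p S) = if S ∈ U then v else if S ∈ V then 1 else J S := by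
    intro v S
    by_cases hS : S ∈ V
    · rw [if_pos hS, show p S = _ from renew_of_mem _ (Finset.mem_coe.2 hS)]; rfl
    · have hSU : S ∉ U := fun h => hS h.1
      rw [if_neg hSU, if_neg hS, show p S = _ from renew_of_notMem _ (by simpa using hS)]; rfl
  have hneg : ∀ v S, K v (q S) = if S ∈ V then -1 else J S := by
    intro v S
    by_cases hS : S ∈ V
    · rw [if_pos hS, show q S = _ from renew_of_mem _ (Finset.mem_coe.2 hS)]; rfl
    · rw [if_neg hS, show q S = _ from renew_of_notMem _ (by simpa using hS)]; rfl
  -- with `U` false the body is two-valued, and at least its value in `J[U/f]`, which is not false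
  have hfalse : (φ.rename p q).eval (K (-1)) = 1 := by
    refine TruthValue.eq_one (PCFormula.eval_ne_zero _ fun T hT => ?_) fun h => hφ ?_
    · obtain ⟨S, hS, rfl | rfl⟩ := PCFormula.mem_atoms_rename hT
      · rw [hpos]
        split_ifs with h₁ h₂
        · decide
        · decide
        · exact fun e => h₂ ((hV S).2 e)
      · rw [hneg]
        split_ifs with h₁
        · decide
        · exact fun e => h₁ ((hV S).2 e)
    · refine le_antisymm (le_of_le_of_eq ?_ h) (SignType.neg_one_le _)
      conv_lhs => rw [← φ.rename_id]
      refine φ.eval_rename_mono (fun S => ?_) fun S => ?_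
      · rw [hpos, Interpretation.update, id]
        split_ifs
        · exact le_rfl
        · exact SignType.le_one (J S)
        · exact le_rfl
      · rw [hneg, Interpretation.update, id]
        have hUV : S ∈ U → S ∈ V := fun h => h.1
        split_ifs <;> first | exact le_rfl | exact SignType.neg_one_le (J S) | tauto
  -- `Provable.of_literals` would require `Θ` to refute the atoms false in the interpretation, so
  -- `U` has to be unknown there; this can only raise the value
  have hunknown : (φ.rename p q).eval (K 0) = 1 := by
    refine le_antisymm (SignType.le_one _) ?_
    rw [← hfalse]
    refine φ.eval_rename_mono (fun S => ?_) fun S => ?_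
    · rw [hpos, hpos]
      split_ifs
      · decide
      · exact le_rfl
      · exact le_rfl
    · rw [hneg, hneg]
  have hmem : Formula.defn (D.diamond V) ∈ Θ :=
    Finset.mem_union_right _ (Finset.mem_insert_self _ _)
  have hrule := Provable.def_right Θ ∅ (D.diamond V) (Sum.inr (Sum.inl ⟨R, hRV⟩)) (φ.rename p q)
    (mem_diamond_rules.2 ⟨R, φ, hr, hRV, rfl, rfl⟩)
  rw [Finset.insert_eq_of_mem hmem] at hrule
  refine hrule ((Provable.of_literals (K := K 0) _ ?_ ?_).1 hunknown)
  · rintro (S | S | S) hS h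
    · have h : J S = 1 := h
      exact .of_mem (Finset.mem_union_right _ (Finset.mem_insert_of_mem
        (weaken_atom_mem (atom_mem_literals (hA (mem_atoms_of_mem_diamond_body hr hS))
          (by rw [← hJ S (by simp [h]), h]))))) (Finset.mem_insert_self _ _)
    · have h : (if S.1 ∈ U then (0 : SignType) else 1) = 1 := h
      by_contra hn
      rw [if_pos ⟨S.2, hn⟩] at h
      exact absurd h (by decide)
    · exact absurd (show (-1 : SignType) = 1 from h) (by decide)
  · rintro (S | S | S) hS h
    · have h : J S = -1 := h
      exact .of_neg_mem (Finset.mem_insert_of_mem (Finset.mem_union_right _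
        (Finset.mem_insert_of_mem (weaken_neg_atom_mem
          (neg_atom_mem_literals (hA (mem_atoms_of_mem_diamond_body hr hS))
            (by rw [← hJ S (by simp [h]), h]))))))
        (.of_mem (Finset.mem_insert_self _ _) (Finset.mem_insert_self _ _))
    · have h : (if S.1 ∈ U then (0 : SignType) else 1) = -1 := h
      split_ifs at h
    · exact .of_neg_mem (A := .atom (Sum.inr (Sum.inr S))) (Finset.mem_insert_of_mem
        (Finset.mem_union_left _ (Finset.mem_image_of_mem _ (Finset.mem_univ S))))
        (.of_mem (Finset.mem_insert_self _ _) (Finset.mem_insert_self _ _))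

/-- The literals of a two-valued interpretation refute every definition that is false in it. -/
theorem Definition.refute {τ : Type*} {D : Definition τ} {I : Interpretation τ} {A : Finset τ}
    (hA : D.atoms ⊆ A) (hI : I.TwoValued) (hD : ¬ D.HoldsIn I) :
    Provable (insert (.defn D) (literals I A)) ∅ := by
  by_contra hnot
  obtain ⟨J, hreach, hterm⟩ := D.exists_isWellFoundedLimit I
  have hJ : ∀ P, J P ≠ 0 → J P = I P := by
    clear hterm
    induction hreach with
    | refl =>
      intro P h
      by_cases hP : P ∈ D.defined
      · simp [Interpretation.update, hP] at h
      · simp [Interpretation.update, hP]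
    | tail _ hs ih =>
      intro P h
      by_contra hne
      exact hnot (hs.provable_of_ne hA hI ih h hne)
  have hunknown : {P | J P = 0} ⊆ D.defined := fun P h => by
    by_contra hP
    exact hI P (by rw [← eq_of_notMem_defined hreach hP]; exact h)
  obtain ⟨V, hV'⟩ := (D.defined_finite.subset hunknown).exists_finset
  have hV : ∀ P, P ∈ V ↔ J P = 0 := hV'
  have hVD : (V : Set τ) ⊆ D.defined := fun P h => hunknown ((hV P).1 h)
  rcases V.eq_empty_or_nonempty with rfl | hne
  · have hJI : J = I := funext fun P => hJ P fun h => by simpa using (hV P).2 h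
    exact hD ⟨hI, hJI ▸ hreach, hJI ▸ hterm⟩
  · refine hnot (.non_total _ _ D V hne hVD Finset.univ.toList (Finset.nodup_toList _)
      (fun P => by simp) ?_ ?_)
    · refine Provable.conj_right _ fun F hF => ?_
      obtain ⟨P, _, rfl⟩ := List.mem_map.1 hF
      simpa using D.diamond_refutes hA hJ hterm hV hVD P
    · refine Provable.conj_right _ fun F hF => ?_
      obtain ⟨P, _, rfl⟩ := List.mem_map.1 hF
      simpa using D.diamond_proves hA hJ hterm hV hVD P

end PCID

theorem mainTheorem4 {τ : Type*} {n : ℕ} (D : Fin n → PCID.Definition τ)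
    (Γ Δ : Finset (PCID.PCFormula τ))
    (hvalid : PCID.Valid
      ((Finset.univ.image fun i => PCID.Formula.defn (D i)) ∪
        Γ.image PCID.PCFormula.toFormula)
      (Δ.image PCID.PCFormula.toFormula)) :
    PCID.Provable
      ((Finset.univ.image fun i => PCID.Formula.defn (D i)) ∪
        Γ.image PCID.PCFormula.toFormula)
      (Δ.image PCID.PCFormula.toFormula) := by
  classical
  let A : Finset τ := (Finset.univ.biUnion fun i => (D i).atoms) ∪
    ((Γ ∪ Δ).biUnion PCID.PCFormula.atoms)
  have hAD : ∀ i, (D i).atoms ⊆ A := fun i P hP =>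
    Finset.mem_union_left _ (Finset.mem_biUnion.2 ⟨i, Finset.mem_univ i, hP⟩)
  have hAF : ∀ φ ∈ Γ ∪ Δ, φ.atoms ⊆ A := fun φ hφ P hP =>
    Finset.mem_union_right _ (Finset.mem_biUnion.2 ⟨φ, hφ, hP⟩)
  refine PCID.Provable.of_forall_literals A fun I hI => ?_
  have lits : ∀ φ ∈ Γ ∪ Δ,
      (φ.eval I = 1 → PCID.Provable (PCID.literals I A) (insert φ.toFormula ∅)) ∧
      (φ.eval I = -1 → PCID.Provable (insert φ.toFormula (PCID.literals I A)) ∅) := by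
    intro φ hφ
    refine PCID.Provable.of_literals φ (fun P hP h => ?_) fun P hP h => ?_
    · exact .of_mem (PCID.atom_mem_literals (hAF φ hφ hP) h) (Finset.mem_insert_self _ _)
    · exact .of_neg_mem
        (Finset.mem_insert_of_mem (PCID.neg_atom_mem_literals (hAF φ hφ hP) h))
        (.of_mem (Finset.mem_insert_self _ _) (Finset.mem_insert_self _ _))
  by_cases hD : ∀ i, (D i).HoldsIn I
  · by_cases hΓ : ∀ φ ∈ Γ, φ.eval I = 1
    · obtain ⟨ψ, hψ, hsat⟩ := hvalid I hI (by
        intro F hF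
        rcases Finset.mem_union.1 hF with hF | hF
        · obtain ⟨i, -, rfl⟩ := Finset.mem_image.1 hF
          exact ⟨hI, by simp [PCID.Formula.eval, hD i]⟩
        · obtain ⟨φ, hφ, rfl⟩ := Finset.mem_image.1 hF
          exact ⟨hI, by rw [PCID.PCFormula.eval_toFormula, hΓ φ hφ]⟩)
      obtain ⟨φ, hφ, rfl⟩ := Finset.mem_image.1 hψ
      have h := (lits φ (Finset.mem_union_right _ hφ)).1
        (by rw [← PCID.PCFormula.eval_toFormula]; exact hsat.2)
      exact (h.mono_left Finset.subset_union_left).mono_right (by simpa using hψ)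
    · push Not at hΓ
      obtain ⟨φ, hφ, hne⟩ := hΓ
      have h := (lits φ (Finset.mem_union_left _ hφ)).2
        (PCID.TruthValue.eq_neg_one (φ.eval_ne_zero fun P _ => hI P) hne)
      refine (h.mono_left (Finset.insert_subset ?_ Finset.subset_union_left)).mono_right
        (Finset.empty_subset _)
      exact Finset.mem_union_right _
        (Finset.mem_union_right _ (Finset.mem_image_of_mem _ hφ))
  · push Not at hD
    obtain ⟨i, hi⟩ := hD
    refine (((D i).refute (hAD i) hI hi).mono_left
      (Finset.insert_subset ?_ Finset.subset_union_left)).mono_right (Finset.empty_subset _)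
    exact Finset.mem_union_right _ (Finset.mem_union_left _
      (Finset.mem_image_of_mem _ (Finset.mem_univ i)))
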